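/- Let $G$ be a noncompact locally compact (Hausdorff) group, let $C(G)$ be the Banach space of bounded continuous complex-valued functions on $G$ with the sup norm, and for $f\in C(G)$ and $x,y\in G$ put ${}_xf(z)=f(xz)$ and ${}_xf_y(z)=f(xzy)$ for $z\in G$. Let $$AP(G)=\{f\in C(G):\{{}_xf: x\in G\}\text{ is relatively norm compact in }C(G)\}$$ be the set of almost periodic functions on $G$, and let $$WS(G)=\{f\in C(G):\{{}_xf_y: x,y\in G\}\text{ is relatively weakly compact in }C(G)\}$$ be the set of strictly weakly almost periodic functions on $G$. (1) If $G$ is an IN-group, i.e. the identity of $G$ has a compact neighborhood that is invariant under all inner automorphisms of $G$, then $AP(G)\subsetneq WS(G)$. (2) If $G$ is nilpotent, then $AP(G)\subsetneq WS(G)$. -/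

import Mathlib

open scoped Topology BoundedContinuousFunction

section TranslationOrbits

variable {G : Type*} [Group G] [TopologicalSpace G] [IsTopologicalGroup G]

/-- The left translate `z ↦ f (x * z)` of a bounded continuous function `f`. -/
noncomputable def leftTranslate (x : G) (f : G →ᵇ ℂ) : G →ᵇ ℂ :=
  f.compContinuous ⟨fun z => x * z, by fun_prop⟩

/-- The two-sided translate `z ↦ f (x * z * y)` of a bounded continuous function `f`. -/
noncomputable def twoSidedTranslate (x y : G) (f : G →ᵇ ℂ) : G →ᵇ ℂ :=
  f.compContinuous ⟨fun z => x * z * y, by fun_prop⟩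

/-- The left orbit of `f`: the set of all its left translates. -/
def leftOrbit (f : G →ᵇ ℂ) : Set (G →ᵇ ℂ) :=
  Set.range fun x : G => leftTranslate x f

/-- The double orbit of `f`: the set of all its two-sided translates. -/
def doubleOrbit (f : G →ᵇ ℂ) : Set (G →ᵇ ℂ) :=
  Set.range fun p : G × G => twoSidedTranslate p.1 p.2 f

end TranslationOrbits

section FunctionSpaces

variable (G : Type*) [Group G] [TopologicalSpace G] [IsTopologicalGroup G]

/-- The almost periodic functions on `G`: the bounded continuous functions whose left orbit is
relatively compact for the sup norm. -/
def AP : Set (G →ᵇ ℂ) :=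
  {f | IsCompact (closure (leftOrbit f))}

/-- The strictly weakly almost periodic functions on `G`: the bounded continuous functions whose
double orbit is relatively compact for the weak topology of the Banach space `G →ᵇ ℂ`. -/
def WS : Set (G →ᵇ ℂ) :=
  {f | IsCompact (closure (toWeakSpace ℂ (G →ᵇ ℂ) '' doubleOrbit f))}

end FunctionSpaces

/-- `G` is an IN-group if the identity has a compact neighborhood that is invariant under all
inner automorphisms. -/
def IsINGroup (G : Type*) [Group G] [TopologicalSpace G] : Prop :=
  ∃ U ∈ 𝓝 (1 : G), IsCompact U ∧ ∀ x : G, ∀ u ∈ U, x * u * x⁻¹ ∈ U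

/-!
The inclusion `AP G ⊆ WS G` holds on every topological group: a totally bounded left orbit forces a
totally bounded right orbit, hence a relatively norm compact double orbit (`AP_subset_WS`).

For strictness the key is a nonzero class function `f` (`f (x * y) = f (y * x)`) with compact
support. Its double orbit is its left orbit. Left translates of a compactly supported function tend
weakly to `0` at infinity (`tendsto_dual_leftTranslate`), so the left orbit together with `0` is
weakly compact and `f ∈ WS G`. On a noncompact group `f ∉ AP G`: the translates keep the norm of `f`,
so no norm cluster point at infinity can be the weak limit `0`.

On an IN-group such a function is `z ↦ μ (z U ∩ U)`, where `μ` is a left Haar measure and `U` a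
compact invariant neighborhood of `1`. It is a class function because `x U = U x` makes `μ`
right invariant.

A nilpotent group is handled by induction on its class. Let `Z` be its center. If `G ⧸ Z` is compact,
then `G` is an IN-group, since only compactly many inner automorphisms occur. If `G ⧸ Z` is not
compact, composition with `G → G ⧸ Z` is an isometry which maps orbits onto orbits, and carries a
function in `WS (G ⧸ Z)` outside `AP (G ⧸ Z)` to one on `G`.
-/

open Filter Set MeasureTheory
open scoped Pointwise

/-! ### Orbits and the inclusion of `AP` in `WS` -/

section Translates

variable {G : Type*} [Group G] [TopologicalSpace G] [IsTopologicalGroup G]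

@[simp]
theorem leftTranslate_apply (x : G) (f : G →ᵇ ℂ) (z : G) : leftTranslate x f z = f (x * z) := rfl

@[simp]
theorem twoSidedTranslate_apply (x y : G) (f : G →ᵇ ℂ) (z : G) :
    twoSidedTranslate x y f z = f (x * z * y) := rfl

theorem isometry_leftTranslate (x : G) : Isometry (leftTranslate x : (G →ᵇ ℂ) → G →ᵇ ℂ) := by
  refine Isometry.of_dist_eq fun f g => le_antisymm ?_ ?_
  · refine (BoundedContinuousFunction.dist_le dist_nonneg).2 fun z => ?_
    exact BoundedContinuousFunction.dist_coe_le_dist (f := f) (g := g) (x * z)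
  · refine (BoundedContinuousFunction.dist_le dist_nonneg).2 fun z => ?_
    simpa using BoundedContinuousFunction.dist_coe_le_dist
      (f := leftTranslate x f) (g := leftTranslate x g) (x⁻¹ * z)

theorem norm_leftTranslate (x : G) (f : G →ᵇ ℂ) : ‖leftTranslate x f‖ = ‖f‖ := by
  have h0 : leftTranslate x (0 : G →ᵇ ℂ) = 0 := rfl
  have h := (isometry_leftTranslate x).dist_eq f 0
  rwa [h0, dist_zero_right, dist_zero_right] at h

theorem mem_AP_iff {f : G →ᵇ ℂ} : f ∈ AP G ↔ TotallyBounded (leftOrbit f) := by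
  refine ⟨fun h => totallyBounded_closure.1 (IsCompact.totallyBounded h), fun h => ?_⟩
  exact (totallyBounded_closure.2 h).isCompact_of_isClosed isClosed_closure

/-- If the left orbit is totally bounded, finitely many left translations approximate all of
them. -/
theorem exists_finite_left_net {f : G →ᵇ ℂ} (hf : TotallyBounded (leftOrbit f)) {ε : ℝ}
    (hε : 0 < ε) :
    ∃ t : Set G, t.Finite ∧ ∀ x, ∃ a ∈ t, dist (leftTranslate x f) (leftTranslate a f) < ε := by
  obtain ⟨s, hs, hfin, hcov⟩ := Metric.finite_approx_of_totallyBounded hf ε hε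
  have hs' : ∀ g ∈ s, ∃ x, leftTranslate x f = g := fun g hg => hs hg
  choose! a ha using hs'
  refine ⟨a '' s, hfin.image a, fun x => ?_⟩
  obtain ⟨g, hg, hxg⟩ := mem_iUnion₂.1 (hcov (mem_range_self x))
  refine ⟨a g, mem_image_of_mem a hg, ?_⟩
  rw [ha g hg]
  exact hxg

/-- Left almost periodic functions are right almost periodic: a right translate is determined up to
`ε` by its values at the finitely many points of a left `ε`-net. -/
theorem totallyBounded_range_rightTranslate {f : G →ᵇ ℂ} (hf : TotallyBounded (leftOrbit f)) :
    TotallyBounded (range fun y : G => twoSidedTranslate 1 y f) := by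
  refine Metric.totallyBounded_iff.2 fun ε hε => ?_
  obtain ⟨t, htfin, ht⟩ := exists_finite_left_net hf (ε := ε / 4) (by positivity)
  have := htfin.fintype
  let Φ : G → t → ℂ := fun y a => f (a * y)
  have hΦ : TotallyBounded (range Φ) := by
    have hb : range Φ ⊆ Metric.closedBall 0 ‖f‖ := by
      rintro _ ⟨y, rfl⟩
      rw [mem_closedBall_zero_iff]
      exact (pi_norm_le_iff_of_nonneg (norm_nonneg f)).2 fun a => f.norm_coe_le_norm _
    exact (isCompact_closedBall _ _).totallyBounded.subset hb
  obtain ⟨s, hs, hsfin, hcov⟩ := Metric.finite_approx_of_totallyBounded hΦ (ε / 4) (by positivity)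
  have hs' : ∀ p ∈ s, ∃ y, Φ y = p := fun p hp => hs hp
  choose! b hb using hs'
  refine ⟨(fun p => twoSidedTranslate 1 (b p) f) '' s, hsfin.image _, ?_⟩
  rintro _ ⟨y, rfl⟩
  obtain ⟨p, hp, hyp⟩ := mem_iUnion₂.1 (hcov (mem_range_self y))
  refine mem_iUnion₂.2 ⟨_, mem_image_of_mem _ hp, ?_⟩
  rw [Metric.mem_ball] at hyp ⊢
  refine lt_of_le_of_lt ((BoundedContinuousFunction.dist_le (C := 3 * (ε / 4)) (by positivity)).2
    fun z => ?_) (by linarith)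
  obtain ⟨a, ha, haz⟩ := ht z
  have h (w : G) : dist (f (z * w)) (f (a * w)) ≤ ε / 4 :=
    (BoundedContinuousFunction.dist_coe_le_dist (f := leftTranslate z f)
      (g := leftTranslate a f) w).trans haz.le
  have h2 : dist (f (a * y)) (f (a * b p)) ≤ ε / 4 := by
    have h3 := dist_le_pi_dist (Φ y) p ⟨a, ha⟩
    rw [← hb p hp] at h3 hyp
    exact h3.trans hyp.le
  simp only [twoSidedTranslate_apply, one_mul]
  have h4 := h (b p)
  rw [dist_comm] at h4
  have h5 := dist_triangle4 (f (z * y)) (f (a * y)) (f (a * b p)) (f (z * b p))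
  linarith [h y]

theorem totallyBounded_doubleOrbit {f : G →ᵇ ℂ} (hf : TotallyBounded (leftOrbit f)) :
    TotallyBounded (doubleOrbit f) := by
  refine Metric.totallyBounded_iff.2 fun ε hε => ?_
  obtain ⟨t, htfin, ht⟩ := exists_finite_left_net hf (ε := ε / 2) (by positivity)
  have hR : TotallyBounded
      (⋃ a ∈ t, leftTranslate a '' range fun y : G => twoSidedTranslate 1 y f) :=
    (totallyBounded_biUnion htfin).2 fun a _ =>
      (totallyBounded_range_rightTranslate hf).image (isometry_leftTranslate a).uniformContinuous
  obtain ⟨s, hsfin, hcov⟩ := Metric.totallyBounded_iff.1 hR (ε / 2) (by positivity)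
  refine ⟨s, hsfin, ?_⟩
  rintro _ ⟨⟨x, y⟩, rfl⟩
  obtain ⟨a, ha, hxa⟩ := ht x
  have hmem : leftTranslate a (twoSidedTranslate 1 y f) ∈
      ⋃ a ∈ t, leftTranslate a '' range fun y : G => twoSidedTranslate 1 y f :=
    mem_iUnion₂.2 ⟨a, ha, mem_image_of_mem _ (mem_range_self y)⟩
  obtain ⟨g, hg, hag⟩ := mem_iUnion₂.1 (hcov hmem)
  refine mem_iUnion₂.2 ⟨g, hg, ?_⟩
  rw [Metric.mem_ball] at hag ⊢
  have h1 : dist (twoSidedTranslate x y f) (leftTranslate a (twoSidedTranslate 1 y f)) ≤ ε / 2 := by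
    refine (BoundedContinuousFunction.dist_le (by positivity)).2 fun z => ?_
    have := (BoundedContinuousFunction.dist_coe_le_dist (f := leftTranslate x f)
      (g := leftTranslate a f) (z * y)).trans hxa.le
    simpa [mul_assoc] using this
  linarith [dist_triangle (twoSidedTranslate x y f) (leftTranslate a (twoSidedTranslate 1 y f)) g]

theorem isCompact_closure_of_subset_isCompact_weakSpace {E : Type*} [NormedAddCommGroup E]
    [NormedSpace ℂ E] {s : Set E} {K : Set (WeakSpace ℂ E)} (hK : IsCompact K)
    (hs : toWeakSpace ℂ E '' s ⊆ K) : IsCompact (closure (toWeakSpace ℂ E '' s)) :=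
  hK.of_isClosed_subset isClosed_closure (closure_minimal hs hK.isClosed)

theorem AP_subset_WS : AP G ⊆ WS G := by
  intro f hf
  have hc : IsCompact (closure (doubleOrbit f)) :=
    (totallyBounded_closure.2 (totallyBounded_doubleOrbit (mem_AP_iff.1 hf))).isCompact_of_isClosed
      isClosed_closure
  exact isCompact_closure_of_subset_isCompact_weakSpace
    (hc.image (toWeakSpaceCLM ℂ (G →ᵇ ℂ)).continuous) (image_mono subset_closure)

end Translates

/-! ### Functions lifted from a quotient group -/

section Pullback

variable {G H : Type*} [Group G] [TopologicalSpace G] [IsTopologicalGroup G]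
  [Group H] [TopologicalSpace H] [IsTopologicalGroup H]

/-- Composition with a continuous surjective homomorphism, as a linear isometry between the spaces
of bounded continuous functions. -/
noncomputable def pullback (π : G →* H) (hc : Continuous π) (hs : Function.Surjective π) :
    (H →ᵇ ℂ) →ₗᵢ[ℂ] (G →ᵇ ℂ) where
  toFun f := f.compContinuous ⟨π, hc⟩
  map_add' _ _ := rfl
  map_smul' _ _ := rfl
  norm_map' f := by
    refine le_antisymm ?_ ?_
    · exact (BoundedContinuousFunction.norm_le (norm_nonneg f)).2 fun z => f.norm_coe_le_norm (π z)
    · refine (BoundedContinuousFunction.norm_le (norm_nonneg _)).2 fun w => ?_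
      obtain ⟨z, rfl⟩ := hs w
      exact (f.compContinuous ⟨π, hc⟩).norm_coe_le_norm z

variable {π : G →* H} (hc : Continuous π) (hs : Function.Surjective π)

omit [IsTopologicalGroup G] [IsTopologicalGroup H] in
@[simp]
theorem pullback_apply (f : H →ᵇ ℂ) (z : G) : pullback π hc hs f z = f (π z) := rfl

theorem leftOrbit_pullback (f : H →ᵇ ℂ) :
    leftOrbit (pullback π hc hs f) = pullback π hc hs '' leftOrbit f := by
  have h (x : G) : leftTranslate x (pullback π hc hs f) =
      pullback π hc hs (leftTranslate (π x) f) := by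
    ext z
    simp
  rw [leftOrbit, leftOrbit, ← range_comp, ← hs.range_comp]
  exact congrArg range (funext h)

theorem doubleOrbit_pullback (f : H →ᵇ ℂ) :
    doubleOrbit (pullback π hc hs f) = pullback π hc hs '' doubleOrbit f := by
  have h (p : G × G) : twoSidedTranslate p.1 p.2 (pullback π hc hs f) =
      pullback π hc hs (twoSidedTranslate (π p.1) (π p.2) f) := by
    ext z
    simp
  rw [doubleOrbit, doubleOrbit, ← range_comp, ← (hs.prodMap hs).range_comp]
  exact congrArg range (funext h)

theorem pullback_mem_AP_iff {f : H →ᵇ ℂ} : pullback π hc hs f ∈ AP G ↔ f ∈ AP H := by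
  rw [mem_AP_iff, mem_AP_iff, leftOrbit_pullback,
    totallyBounded_image_iff (pullback π hc hs).isometry.isUniformInducing]

theorem pullback_mem_WS {f : H →ᵇ ℂ} (hf : f ∈ WS H) : pullback π hc hs f ∈ WS G := by
  let T := WeakSpace.map (pullback π hc hs).toContinuousLinearMap
  refine isCompact_closure_of_subset_isCompact_weakSpace (IsCompact.image hf T.continuous) ?_
  rw [doubleOrbit_pullback]
  rintro _ ⟨_, ⟨g, hg, rfl⟩, rfl⟩
  exact ⟨toWeakSpace ℂ _ g, subset_closure (mem_image_of_mem _ hg), rfl⟩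

include hc hs in
/-- Strictness of the inclusion passes from a quotient group to the group. -/
theorem AP_ssubset_WS_of_surjective (h : AP H ⊂ WS H) : AP G ⊂ WS G := by
  obtain ⟨f, hfW, hfA⟩ := exists_of_ssubset h
  exact ssubset_of_subset_not_subset AP_subset_WS fun hsub =>
    hfA ((pullback_mem_AP_iff hc hs).1 (hsub (pullback_mem_WS hc hs hfW)))

end Pullback

/-! ### Translates of compactly supported functions -/

section CompactSupport

variable {G : Type*} [Group G] [TopologicalSpace G] [IsTopologicalGroup G]

theorem continuous_leftTranslate {f : G →ᵇ ℂ} (hf : HasCompactSupport f) :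
    Continuous fun x : G => leftTranslate x f := by
  -- In this uniformity `x * z` and `y * z` are close uniformly in `z` when `x` and `y` are close.
  let := IsTopologicalGroup.rightUniformSpace G
  have hu : UniformContinuous f := hf.uniformContinuous_of_continuous f.continuous
  refine continuous_iff_continuousAt.2 fun x => Metric.tendsto_nhds.2 fun ε hε => ?_
  have h2 : ∀ᶠ p in uniformity G, dist (f p.1) (f p.2) < ε / 2 :=
    hu (Metric.dist_mem_uniformity (half_pos hε))
  obtain ⟨V, hV, hVs⟩ := mem_comap.1 h2
  have ht : Tendsto (fun y : G => x * y⁻¹) (𝓝 x) (𝓝 1) := by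
    have : Continuous fun y : G => x * y⁻¹ := by fun_prop
    simpa using this.tendsto x
  filter_upwards [ht hV] with y hy
  refine lt_of_le_of_lt ((BoundedContinuousFunction.dist_le (half_pos hε).le).2 fun z => ?_)
    (half_lt_self hε)
  refine (show dist (f (y * z)) (f (x * z)) < ε / 2 from hVs (a := (y * z, x * z)) ?_).le
  simpa [mul_assoc] using hy

/-- If `p` holds at points arbitrarily far out, it holds on arbitrarily large finite sets of points
whose translates of `f` have pairwise disjoint supports. -/
theorem exists_finset_disjoint_support_leftTranslate {f : G →ᵇ ℂ} (hf : HasCompactSupport f)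
    {p : G → Prop} (hp : ∃ᶠ x in cocompact G, p x) (n : ℕ) :
    ∃ s : Finset G, s.card = n ∧ (∀ x ∈ s, p x) ∧
      ∀ x ∈ s, ∀ y ∈ s, ∀ z, f (x * z) ≠ 0 → f (y * z) ≠ 0 → x = y := by
  classical
  induction n with
  | zero => exact ⟨∅, by simp⟩
  | succ n ih =>
    obtain ⟨s, hcard, hps, hdisj⟩ := ih
    -- Translates by `x` and `y` overlap only if `x` lies in `tsupport f * (tsupport f)⁻¹ * y`.
    let K : Set G := tsupport f * (tsupport f)⁻¹ * (s : Set G) ∪ s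
    have hK : IsCompact K :=
      ((hf.isCompact.mul hf.isCompact.inv).mul s.finite_toSet.isCompact).union
        s.finite_toSet.isCompact
    obtain ⟨x, hpx, hxK⟩ := (hp.and_eventually hK.compl_mem_cocompact).exists
    have hx (y : G) (hy : y ∈ s) (z : G) (h1 : f (x * z) ≠ 0) (h2 : f (y * z) ≠ 0) : False := by
      refine hxK (Or.inl ?_)
      have h3 := mul_mem_mul (mul_mem_mul (subset_tsupport f h1)
        (inv_mem_inv.2 (subset_tsupport f h2))) (Finset.mem_coe.2 hy)
      simpa [mul_assoc] using h3
    have hxs : x ∉ s := fun h => hxK (Or.inr h)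
    refine ⟨insert x s, by simp [hxs, hcard], ?_, ?_⟩
    · simpa [hpx] using hps
    · intro a ha b hb z h1 h2
      rcases Finset.mem_insert.1 ha with rfl | ha <;> rcases Finset.mem_insert.1 hb with rfl | hb
      · rfl
      · exact (hx b hb z h1 h2).elim
      · exact (hx a ‹a ∈ s› z h2 h1).elim
      · exact hdisj a ha b hb z h1 h2

/-- The left translates of a compactly supported function tend weakly to zero at infinity.
If a functional `φ` stayed large along translates with disjoint supports, sums of
unimodular multiples of these translates would have norm at most `‖f‖` and arbitrarily large image
under `φ`. -/
theorem tendsto_dual_leftTranslate {f : G →ᵇ ℂ} (hf : HasCompactSupport f)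
    (φ : (G →ᵇ ℂ) →L[ℂ] ℂ) :
    Tendsto (fun x => φ (leftTranslate x f)) (cocompact G) (𝓝 0) := by
  refine Metric.tendsto_nhds.2 fun ε hε => ?_
  by_contra hcon
  have hfreq : ∃ᶠ x in cocompact G, ε ≤ ‖φ (leftTranslate x f)‖ := by
    refine (not_eventually.1 hcon).mono fun x hx => ?_
    rwa [dist_zero_right, not_lt] at hx
  obtain ⟨n, hn⟩ := exists_nat_gt (‖φ‖ * ‖f‖ / ε)
  obtain ⟨s, hcard, hs, hdisj⟩ := exists_finset_disjoint_support_leftTranslate hf hfreq n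
  -- `c` rotates the value of `φ` at each translate onto the nonnegative reals.
  have hphase (w : ℂ) : ∃ c : ℂ, ‖c‖ ≤ 1 ∧ c * w = ‖w‖ := by
    refine ⟨(starRingEnd ℂ) w / ‖w‖, ?_, ?_⟩
    · rw [norm_div, RCLike.norm_conj, Complex.norm_real, norm_norm]
      exact div_self_le_one _
    · rw [div_mul_eq_mul_div, Complex.conj_mul', sq, mul_self_div_self]
  choose c hc1 hcφ using fun x => hphase (φ (leftTranslate x f))
  let h : G →ᵇ ℂ := ∑ x ∈ s, c x • leftTranslate x f
  have hnorm : ‖h‖ ≤ ‖f‖ := by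
    refine (BoundedContinuousFunction.norm_le (norm_nonneg f)).2 fun z => ?_
    have hz : h z = ∑ x ∈ s, c x * f (x * z) := by simp [h]
    rw [hz]
    by_cases hex : ∃ x ∈ s, f (x * z) ≠ 0
    · obtain ⟨x, hx, hxz⟩ := hex
      rw [Finset.sum_eq_single_of_mem x hx]
      · rw [norm_mul]
        exact (mul_le_of_le_one_left (norm_nonneg _) (hc1 x)).trans (f.norm_coe_le_norm _)
      · intro y hy hyx
        have : f (y * z) = 0 := by
          by_contra hne
          exact hyx (hdisj y hy x hx z hne hxz)
        rw [this, mul_zero]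
    · push Not at hex
      rw [Finset.sum_eq_zero fun x hx => by rw [hex x hx, mul_zero]]
      simp
  have hφh : φ h = ((∑ x ∈ s, ‖φ (leftTranslate x f)‖ : ℝ) : ℂ) := by
    simp [h, map_sum, hcφ]
  have hlow : n * ε ≤ ‖φ h‖ := by
    rw [hφh, Complex.norm_real, Real.norm_of_nonneg (Finset.sum_nonneg fun _ _ => norm_nonneg _)]
    calc (n : ℝ) * ε = ∑ _x ∈ s, ε := by simp [hcard]
      _ ≤ _ := Finset.sum_le_sum hs
  have hup : ‖φ h‖ ≤ ‖φ‖ * ‖f‖ := (φ.le_opNorm h).trans (by gcongr)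
  rw [div_lt_iff₀ hε] at hn
  linarith

theorem tendsto_toWeakSpace_leftTranslate {f : G →ᵇ ℂ} (hf : HasCompactSupport f) :
    Tendsto (fun x => toWeakSpace ℂ (G →ᵇ ℂ) (leftTranslate x f)) (cocompact G) (𝓝 0) := by
  refine (WeakBilin.tendsto_iff_forall_eval_tendsto (topDualPairing ℂ (G →ᵇ ℂ)).flip ?_).2 ?_
  · intro u v huv
    exact SeparatingDual.eq_iff_forall_dual_eq (R := ℂ) |>.2 fun φ => DFunLike.congr_fun huv φ
  · intro φ
    have h := tendsto_dual_leftTranslate hf φ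
    rw [← map_zero φ] at h
    exact h

/-- A compactly supported class function is strictly weakly almost periodic: its double orbit is
its left orbit, which together with `0` is a weakly continuous image of the one-point
compactification of `G`. -/
theorem mem_WS_of_hasCompactSupport {f : G →ᵇ ℂ} (hf : HasCompactSupport f)
    (hcl : ∀ x y, f (x * y) = f (y * x)) : f ∈ WS G := by
  have hcont : Continuous fun x => toWeakSpace ℂ (G →ᵇ ℂ) (leftTranslate x f) :=
    (toWeakSpaceCLM ℂ (G →ᵇ ℂ)).continuous.comp (continuous_leftTranslate hf)
  refine isCompact_closure_of_subset_isCompact_weakSpace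
    ((tendsto_toWeakSpace_leftTranslate hf).isCompact_insert_range_of_cocompact hcont) ?_
  rintro _ ⟨_, ⟨⟨x, y⟩, rfl⟩, rfl⟩
  refine Or.inr ⟨y * x, congrArg _ ?_⟩
  ext z
  simp [hcl (x * z) y, ← mul_assoc]

/-- On a noncompact group, a norm cluster point of the translates of `f` at infinity would vanish by
weak convergence and have the norm of `f`. -/
theorem notMem_AP_of_hasCompactSupport [NoncompactSpace G] {f : G →ᵇ ℂ}
    (hf : HasCompactSupport f) (h0 : f ≠ 0) : f ∉ AP G := by
  intro hAP
  have hle : map (fun x : G => leftTranslate x f) (cocompact G) ≤ 𝓟 (closure (leftOrbit f)) :=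
    tendsto_principal.2 (Eventually.of_forall fun x => subset_closure ⟨x, rfl⟩)
  obtain ⟨g, hgC, hg⟩ := IsCompact.exists_clusterPt hAP hle
  have hg0 : g = 0 := by
    refine SeparatingDual.eq_iff_forall_dual_eq (R := ℂ) |>.2 fun φ => ?_
    rw [map_zero]
    have h1 : MapClusterPt (φ g) (cocompact G) fun x => φ (leftTranslate x f) :=
      MapClusterPt.continuousAt_comp φ.continuous.continuousAt hg
    exact eq_of_nhds_neBot (h1.clusterPt.mono (tendsto_dual_leftTranslate hf φ)).neBot
  have hnorm : closure (leftOrbit f) ⊆ {u | ‖u‖ = ‖f‖} := by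
    refine closure_minimal ?_ (isClosed_eq continuous_norm continuous_const)
    rintro _ ⟨x, rfl⟩
    exact norm_leftTranslate x f
  have hgf : ‖g‖ = ‖f‖ := hnorm hgC
  rw [hg0, norm_zero] at hgf
  exact h0 (norm_eq_zero.1 hgf.symm)

end CompactSupport

/-! ### Class functions on IN-groups -/

section INGroup

variable {G : Type*} [Group G] [TopologicalSpace G] [IsTopologicalGroup G]

section Haar

variable [LocallyCompactSpace G] [MeasurableSpace G] [BorelSpace G] {μ : Measure G}
  [μ.IsHaarMeasure] [μ.Regular] {U : Set G}

/-- Haar measure on an IN-group is right invariant: right translation by `x` scales it by a constant,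
and that constant is `1` since `U x = x U` has the same finite nonzero measure as `U`. -/
theorem measure_preimage_mul_right_of_conj_invariant (hUc : IsCompact U) (hU : U ∈ 𝓝 (1 : G))
    (hconj : ∀ x : G, ∀ u ∈ U, x * u * x⁻¹ ∈ U) (x : G) (A : Set G) :
    μ ((fun z => z * x) ⁻¹' A) = μ A := by
  have hreg : (μ.map (fun z => z * x)).Regular := Measure.Regular.map (Homeomorph.mulRight x)
  have hsmul := Measure.isMulLeftInvariant_eq_smul_of_regular (μ.map (fun z => z * x)) μ
  set c := Measure.haarScalarFactor (μ.map (fun z => z * x)) μ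
  have hmap (B : Set G) : μ ((fun z => z * x) ⁻¹' B) = c * μ B := by
    have h := congrArg (fun ν : Measure G => ν B) hsmul
    simp only [Measure.smul_apply] at h
    exact ((Homeomorph.mulRight x).toMeasurableEquiv.map_apply B).symm.trans h
  have hpre : (fun z => z * x) ⁻¹' U = (fun z => x * z) ⁻¹' U := by
    ext z
    refine ⟨fun h => ?_, fun h => ?_⟩
    · simpa [mul_assoc] using hconj x _ h
    · simpa [mul_assoc] using hconj x⁻¹ _ h
  have hc := hmap U
  rw [hpre, measure_preimage_mul] at hc
  have hpos : μ U ≠ 0 := (Measure.measure_pos_of_mem_nhds μ hU).ne'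
  have hc1 : (c : ENNReal) = 1 :=
    (ENNReal.mul_eq_right hpos hUc.measure_lt_top.ne).1 hc.symm
  rw [hmap A, hc1, one_mul]

theorem continuous_measureReal_smul_inter (hUc : IsCompact U) (hUcl : IsClosed U) :
    Continuous fun z : G => μ.real (z • U ∩ U) := by
  have hlim : Tendsto (fun g : G => μ.real (g • U \ U)) (𝓝 1) (𝓝 0) := by
    have h := tendsto_measure_smul_sdiff_isCompact_isClosed (μ := μ) hUc hUcl
    exact (ENNReal.tendsto_toReal ENNReal.zero_ne_top).comp h
  have hfin (z : G) : μ (z • U ∩ U) ≠ ⊤ :=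
    ((measure_mono inter_subset_right).trans_lt hUc.measure_lt_top).ne
  have hle (z w : G) : μ.real (z • U ∩ U) ≤ μ.real (w • U ∩ U) + μ.real ((w⁻¹ * z) • U \ U) := by
    have hsub : z • U ∩ U ⊆ (w • U ∩ U) ∪ w • ((w⁻¹ * z) • U \ U) := by
      rintro a ⟨haz, haU⟩
      by_cases haw : a ∈ w • U
      · exact Or.inl ⟨haw, haU⟩
      · refine Or.inr ?_
        rw [smul_set_sdiff, smul_smul, mul_inv_cancel_left]
        exact ⟨haz, haw⟩
    have hfin' : μ (w • ((w⁻¹ * z) • U \ U)) ≠ ⊤ := by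
      rw [measure_smul]
      refine ((measure_mono sdiff_subset).trans_lt ?_).ne
      exact (hUc.smul _).measure_lt_top
    refine (measureReal_mono hsub (measure_union_ne_top (hfin w) hfin')).trans ?_
    refine (measureReal_union_le _ _).trans_eq ?_
    simp [measureReal_def, measure_smul]
  refine continuous_iff_continuousAt.2 fun w => ?_
  have h1 : Tendsto (fun z : G => μ.real ((w⁻¹ * z) • U \ U)) (𝓝 w) (𝓝 0) := by
    refine hlim.comp ?_
    have : Continuous fun z : G => w⁻¹ * z := by fun_prop
    simpa using this.tendsto w
  have h2 : Tendsto (fun z : G => μ.real ((z⁻¹ * w) • U \ U)) (𝓝 w) (𝓝 0) := by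
    refine hlim.comp ?_
    have : Continuous fun z : G => z⁻¹ * w := by fun_prop
    simpa using this.tendsto w
  refine tendsto_iff_dist_tendsto_zero.2 (squeeze_zero (fun _ => dist_nonneg) (fun z => ?_)
    (by simpa using h1.add h2))
  have h3 := hle z w
  have h4 := hle w z
  have h5 : 0 ≤ μ.real ((w⁻¹ * z) • U \ U) := measureReal_nonneg
  have h6 : 0 ≤ μ.real ((z⁻¹ * w) • U \ U) := measureReal_nonneg
  rw [Real.dist_eq]
  exact abs_le.2 ⟨by linarith, by linarith⟩

/-- The function `z ↦ μ (z U ∩ U)` is a class function: `x y U ∩ U` is a left translate of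
`y U ∩ x⁻¹ U`, and `y x U ∩ U` is the right translate of the same set `y U ∩ U x⁻¹` by `x`. -/
theorem measureReal_smul_inter_mul_comm (hUc : IsCompact U) (hU : U ∈ 𝓝 (1 : G))
    (hconj : ∀ x : G, ∀ u ∈ U, x * u * x⁻¹ ∈ U) (x y : G) :
    μ.real ((x * y) • U ∩ U) = μ.real ((y * x) • U ∩ U) := by
  have h1 : μ ((x * y) • U ∩ U) = μ (y • U ∩ x⁻¹ • U) := by
    rw [← measure_smul μ x (y • U ∩ x⁻¹ • U), smul_set_inter, smul_smul, smul_inv_smul]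
  have h2 : (fun z => z * x) ⁻¹' ((y * x) • U ∩ U) = y • U ∩ x⁻¹ • U := by
    have hiff (z : G) : x⁻¹ * z * x ∈ U ↔ z ∈ U := by
      refine ⟨fun h => ?_, fun h => ?_⟩
      · simpa [mul_assoc] using hconj x _ h
      · simpa [mul_assoc] using hconj x⁻¹ _ h
    ext z
    simp only [mem_preimage, mem_inter_iff, mem_smul_set_iff_inv_smul_mem, smul_eq_mul, inv_inv,
      mul_inv_rev]
    rw [← hiff (y⁻¹ * z), ← hiff (x * z)]
    simp [mul_assoc]
  rw [measureReal_def, measureReal_def, h1, ← h2,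
    measure_preimage_mul_right_of_conj_invariant hUc hU hconj]

end Haar

theorem exists_class_function_hasCompactSupport [T2Space G] [LocallyCompactSpace G]
    (h : IsINGroup G) :
    ∃ f : G →ᵇ ℂ, HasCompactSupport f ∧ (∀ x y, f (x * y) = f (y * x)) ∧ f ≠ 0 := by
  obtain ⟨U, hU, hUc, hconj⟩ := h
  borelize G
  let μ : Measure G := Measure.haar
  let F : C(G, ℂ) := ⟨fun z => (μ.real (z • U ∩ U) : ℂ),
    Complex.continuous_ofReal.comp (continuous_measureReal_smul_inter hUc hUc.isClosed)⟩
  have hF : HasCompactSupport F := by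
    refine HasCompactSupport.intro (hUc.mul hUc.inv) fun z hz => ?_
    have hempty : z • U ∩ U = ∅ := by
      refine eq_empty_of_forall_notMem ?_
      rintro _ ⟨⟨u, hu, rfl⟩, hzu⟩
      exact hz (by simpa using mul_mem_mul hzu (inv_mem_inv.2 hu))
    simp [F, hempty]
  obtain ⟨C, hC⟩ := hF.exists_bound_of_continuous F.continuous
  refine ⟨BoundedContinuousFunction.ofNormedAddCommGroup F F.continuous C hC, hF,
    fun x y => ?_, fun h0 => ?_⟩
  · exact congrArg Complex.ofReal (measureReal_smul_inter_mul_comm hUc hU hconj x y)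
  · have h1 : (μ.real ((1 : G) • U ∩ U) : ℂ) = 0 := DFunLike.congr_fun h0 1
    rw [one_smul, inter_self, Complex.ofReal_eq_zero] at h1
    exact (ENNReal.toReal_pos (Measure.measure_pos_of_mem_nhds μ hU).ne'
      hUc.measure_lt_top.ne).ne' h1

theorem AP_ssubset_WS_of_isINGroup [T2Space G] [LocallyCompactSpace G] [NoncompactSpace G]
    (h : IsINGroup G) : AP G ⊂ WS G := by
  obtain ⟨f, hf, hcl, h0⟩ := exists_class_function_hasCompactSupport h
  exact ssubset_of_subset_not_subset AP_subset_WS fun hsub =>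
    notMem_AP_of_hasCompactSupport hf h0 (hsub (mem_WS_of_hasCompactSupport hf hcl))

end INGroup

/-! ### Nilpotent groups -/

section Nilpotent

theorem isClosed_center {G : Type*} [Group G] [TopologicalSpace G] [IsTopologicalGroup G]
    [T2Space G] : IsClosed (Subgroup.center G : Set G) := by
  have h : (Subgroup.center G : Set G) = ⋂ g : G, {z | g * z = z * g} := by
    ext z
    simp [Subgroup.mem_center_iff]
  rw [h]
  exact isClosed_iInter fun g => isClosed_eq (by fun_prop) (by fun_prop)

/-- If `G` is compact modulo its center, the conjugates of a compact neighborhood of `1` by all of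
`G` are its conjugates by a compact set, so that their union is a compact invariant
neighborhood. -/
theorem isINGroup_of_compactSpace_quotient_center {G : Type*} [Group G] [TopologicalSpace G]
    [IsTopologicalGroup G] [LocallyCompactSpace G] [CompactSpace (G ⧸ Subgroup.center G)] :
    IsINGroup G := by
  obtain ⟨V, hVc, hV⟩ := exists_compact_mem_nhds (1 : G)
  let π : G → G ⧸ Subgroup.center G := QuotientGroup.mk
  have hnhds (q : G ⧸ Subgroup.center G) : ∃ g : G, π '' (g • V) ∈ 𝓝 q := by
    obtain ⟨g, rfl⟩ := QuotientGroup.mk_surjective q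
    refine ⟨g, QuotientGroup.isOpenMap_coe.image_mem_nhds ?_⟩
    simpa using smul_mem_nhds_smul g hV
  choose g hg using hnhds
  obtain ⟨t, -, ht⟩ := isCompact_univ.elim_nhds_subcover (fun q => π '' (g q • V)) fun q _ => hg q
  let K : Set G := ⋃ q ∈ t, g q • V
  have hK : IsCompact K := t.isCompact_biUnion fun q _ => hVc.smul (g q)
  have hKπ (x : G) : ∃ k ∈ K, ∀ u, x * u * x⁻¹ = k * u * k⁻¹ := by
    obtain ⟨q, hq, k, hk, hkx⟩ := mem_iUnion₂.1 (ht (mem_univ (π x)))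
    refine ⟨k, mem_iUnion₂.2 ⟨q, hq, hk⟩, fun u => ?_⟩
    have hz : k⁻¹ * x ∈ Subgroup.center G := QuotientGroup.eq.1 hkx
    have hcomm := Subgroup.mem_center_iff.1 hz u
    calc x * u * x⁻¹ = k * ((k⁻¹ * x) * u) * x⁻¹ := by group
      _ = k * (u * (k⁻¹ * x)) * x⁻¹ := by rw [hcomm]
      _ = k * u * k⁻¹ := by group
  refine ⟨(fun p : G × G => p.1 * p.2 * p.1⁻¹) '' (K ×ˢ V), ?_, (hK.prod hVc).image (by fun_prop),
    ?_⟩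
  · obtain ⟨k, hk, hk1⟩ := hKπ 1
    refine mem_of_superset hV fun v hv => ⟨(k, v), ⟨hk, hv⟩, ?_⟩
    simpa using (hk1 v).symm
  · rintro x _ ⟨⟨k, v⟩, ⟨hk, hv⟩, rfl⟩
    obtain ⟨l, hl, hlx⟩ := hKπ (x * k)
    refine ⟨(l, v), ⟨hl, hv⟩, ?_⟩
    simp only
    rw [← hlx v]
    group

/-- Induction on the nilpotency class. If `G` is compact modulo its center, it is an IN-group;
otherwise the claim lifts from the noncompact quotient by the center. -/
theorem AP_ssubset_WS_of_isNilpotent (G : Type*) [Group G] [Group.IsNilpotent G]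
    [TopologicalSpace G] [IsTopologicalGroup G] [T2Space G] [LocallyCompactSpace G]
    [NoncompactSpace G] : AP G ⊂ WS G := by
  revert ‹NoncompactSpace G› ‹LocallyCompactSpace G› ‹T2Space G› ‹IsTopologicalGroup G›
    ‹TopologicalSpace G›
  refine Group.nilpotent_center_quotient_ind (P := fun G _ _ =>
    ∀ [TopologicalSpace G] [IsTopologicalGroup G] [T2Space G] [LocallyCompactSpace G]
      [NoncompactSpace G], AP G ⊂ WS G) G ?_ ?_
  · intro G _ _ _ _ _ _ hnc
    exact (not_compactSpace_iff.2 hnc inferInstance).elim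
  · intro G _ _ ih _ _ _ _ _
    have := isClosed_center (G := G)
    by_cases hc : CompactSpace (G ⧸ Subgroup.center G)
    · exact AP_ssubset_WS_of_isINGroup isINGroup_of_compactSpace_quotient_center
    · have := not_compactSpace_iff.1 hc
      exact AP_ssubset_WS_of_surjective (π := QuotientGroup.mk' (Subgroup.center G))
        QuotientGroup.continuous_mk QuotientGroup.mk_surjective ih

end Nilpotent

theorem theorem3p2 (G : Type*) [Group G] [TopologicalSpace G] [IsTopologicalGroup G]
    [T2Space G] [LocallyCompactSpace G] [NoncompactSpace G] :
    (IsINGroup G → AP G ⊂ WS G) ∧ (Group.IsNilpotent G → AP G ⊂ WS G) :=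
  ⟨AP_ssubset_WS_of_isINGroup, fun _ => AP_ssubset_WS_of_isNilpotent G⟩
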